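/- Let $d\ge 1$ and let $X=(\Omega,\mathcal F,\{\mathbb P_x\}_{x\in\mathbb R^d},\{\mathcal F_t\}_{t\ge0},\{\theta_t\}_{t\ge0},\{X_t\}_{t\ge0})$ be a time-homogeneous Markov process with state space $(\mathbb R^d,\mathcal B(\mathbb R^d))$, with $\mathbb P_x(X_0=x)=1$ and possibly with finite lifetime (after which it stays in a cemetery point, where functions on $\mathbb R^d$ are set to $0$). Let $P_tf(x)=\mathbb E_x[f(X_t)]$, let $C_\infty(\mathbb R^d)$ be the space of continuous real functions vanishing at infinity, and let $B_r(x)$ denote the open ball of radius $r$ centred at $x$. Assume that $X$ is a Lévy-type process with Lévy quadruple $(a,b,c,\nu)$, that is: 1. (Feller) $P_t(C_\infty(\mathbb R^d))\subseteq C_\infty(\mathbb R^d)$ for all $t\ge0$, and $\lim_{t\to0}\|P_tf-f\|_\infty=0$ for all $f\in C_\infty(\mathbb R^d)$. 2. For every $f\in C_c^\infty(\mathbb R^d)$ the limit $\mathcal A f=\lim_{t\to0}(P_tf-f)/t$ exists in the supremum norm. 3. For every $f\in C_c^\infty(\mathbb R^d)$ and $x\in\mathbb R^d$, $$\mathcal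 A f(x)=-\int_{\mathbb R^d}q(x,\xi)\,e^{i\langle\xi,x\rangle}\hat f(\xi)\,d\xi,\qquad \hat f(\xi)=(2\pi)^{-d}\int_{\mathbb R^d}e^{-i\langle\xi,x\rangle}f(x)\,dx,$$ with symbol $$q(x,\xi)=a(x)-i\langle\xi,b(x)\rangle+\tfrac12\langle\xi,c(x)\xi\rangle+\int_{\mathbb R^d}\bigl(1-e^{i\langle\xi,y\rangle}+i\langle\xi,y\rangle\mathbf 1_{B_1(0)}(y)\bigr)\,\nu(x,dy),$$ where $a\ge0$, $b$ ($\mathbb R^d$-valued) and $c$ (with values in the symmetric non-negative definite $d\times d$ matrices) are Borel measurable, and $\nu(x,dy)$ is a Borel kernel with $\nu(x,\{0\})=0$ and $\int_{\mathbb R^d}(1\wedge|y|^2)\,\nu(x,dy)<\infty$ for all $x$. 4. $q(x,0)=a(x)=0$ for all $x\in\mathbb R^d$. Suppose that there are constants $R>r\ge0$ such that (i) $\inf_{x\in K}\nu(x,O)>0$ for every non-empty open set $O\subseteq B_R(0)\setminus B_r(0)$ and every non-empty compact set $K\subset\mathbb R^d$; (ii) the $[0,\infty]$-valued function $x\mapsto\int_{\mathbb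 R^d}f(y+x)\,\nu(x,dy)$ is lower semicontinuous for every non-negative lower semicontinuous function $f:\mathbb R^d\to\mathbb R$. Then $X$ is open-set irreducible, that is, $\mathbb P_x(X_t\in O)>0$ for every $t>0$, every $x\in\mathbb R^d$ and every non-empty open set $O\subseteq\mathbb R^d$. -/

import Mathlib

open MeasureTheory ProbabilityTheory Filter Topology
open scoped NNReal ENNReal

noncomputable section

namespace LevyType

/-- The Euclidean space `ℝ^d`. -/
abbrev Rd (d : ℕ) : Type := EuclideanSpace ℝ (Fin d)

/-- Membership in `B_b(ℝ^d)`, the bounded Borel measurable functions. -/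
def MemBb {d : ℕ} (f : Rd d → ℝ) : Prop :=
  Measurable f ∧ ∃ C : ℝ, ∀ x, |f x| ≤ C

/-- Membership in `C_∞(ℝ^d)`, the continuous functions vanishing at infinity. -/
def MemCInfty {d : ℕ} (f : Rd d → ℝ) : Prop :=
  Continuous f ∧ Tendsto f (cocompact (Rd d)) (𝓝 0)

/-- Membership in `C_c^∞(ℝ^d)`, the smooth functions with compact support. -/
def MemCcInfty {d : ℕ} (f : Rd d → ℝ) : Prop :=
  ContDiff ℝ ((⊤ : ℕ∞) : WithTop ℕ∞) f ∧ HasCompactSupport f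

/-- The usual extension of a function on `ℝ^d` by `0` to the cemetery point `∞`. -/
def extendZero {d : ℕ} (f : Rd d → ℝ) (z : OnePoint (Rd d)) : ℝ :=
  z.elim 0 f

/-- A (normal, time-homogeneous, possibly killed) Markov process
`(Ω, ℱ, {P_x}, {ℱ_t}, {θ_t}, {X_t})` with state space `(ℝ^d, ℬ(ℝ^d))`.
The cemetery is the point `∞` of `OnePoint (Rd d)`. The σ-algebra on `ℝ^d ∪ {∞}` is the one
generated by the Borel sets of `ℝ^d`, so measurability of `X_t` is stated on those sets. -/
structure MarkovProcess (d : ℕ) (Ω : Type*) [mΩ : MeasurableSpace Ω] where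
  /-- the law of the process started at a point -/
  P : Rd d → Measure Ω
  isProbabilityMeasure : ∀ x, IsProbabilityMeasure (P x)
  /-- the filtration -/
  ℱ : Filtration ℝ≥0 mΩ
  /-- the shift operators -/
  θ : ℝ≥0 → Ω → Ω
  /-- the trajectories -/
  X : ℝ≥0 → Ω → OnePoint (Rd d)
  adapted : ∀ (t : ℝ≥0) (B : Set (Rd d)), MeasurableSet B →
    MeasurableSet[ℱ t] (X t ⁻¹' ((↑) '' B))
  /-- the cemetery is absorbing -/
  absorbing : ∀ (s t : ℝ≥0) (ω : Ω), s ≤ t → X s ω = OnePoint.infty → X t ω = OnePoint.infty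
  shift : ∀ (s t : ℝ≥0) (ω : Ω), X s (θ t ω) = X (s + t) ω
  measurable_law : ∀ (t : ℝ≥0) (B : Set (Rd d)), MeasurableSet B →
    Measurable fun x => P x (X t ⁻¹' ((↑) '' B))
  normal : ∀ x : Rd d, ∀ᵐ ω ∂(P x), X 0 ω = (x : OnePoint (Rd d))
  /-- the Markov property `P_x(X_{s+t} ∈ B | ℱ_s) = P_{X_s}(X_t ∈ B)` for Borel `B ⊆ ℝ^d`; the
  right-hand side is `0` where `X_s` is the cemetery -/
  markov : ∀ (x : Rd d) (s t : ℝ≥0) (B : Set (Rd d)), MeasurableSet B →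
    (P x)⟦X (s + t) ⁻¹' ((↑) '' B) | ℱ s⟧ =ᵐ[P x]
      fun ω => extendZero (fun y => (P y).real (X t ⁻¹' ((↑) '' B))) (X s ω)

namespace MarkovProcess

variable {d : ℕ} {Ω : Type*} [MeasurableSpace Ω]

/-- `P_t f(x) = E_x[f(X_t)]`, with `f` put to `0` at the cemetery. -/
def semigroup (M : MarkovProcess d Ω) (t : ℝ≥0) (f : Rd d → ℝ) (x : Rd d) : ℝ :=
  ∫ ω, extendZero f (M.X t ω) ∂(M.P x)

/-- `M` is a Feller process: its semigroup maps `C_∞` to `C_∞` and is strongly continuous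
on `C_∞` for the supremum norm. -/
structure IsFeller (M : MarkovProcess d Ω) : Prop where
  feller : ∀ (t : ℝ≥0) (f : Rd d → ℝ), MemCInfty f → MemCInfty (M.semigroup t f)
  stronglyContinuous : ∀ f : Rd d → ℝ, MemCInfty f →
    TendstoUniformly (fun (t : ℝ≥0) x => M.semigroup t f x) f (𝓝[>] 0)

/-- The graph of the Feller generator: `f ∈ C_∞` lies in the domain and is sent to `g ∈ B_b`, where
`g` is the limit of `(P_t f - f) / t` as `t → 0` in the supremum norm. -/
def FellerGenerator (M : MarkovProcess d Ω) (f g : Rd d → ℝ) : Prop :=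
  MemBb f ∧ MemCInfty f ∧ MemBb g ∧
    TendstoUniformly (fun (t : ℝ≥0) x => (M.semigroup t f x - f x) / (t : ℝ)) g (𝓝[>] 0)

/-- Open-set irreducibility: `P_x(X_t ∈ O) > 0` for all `t > 0`, `x` and non-empty open `O`. -/
def OpenSetIrreducible (M : MarkovProcess d Ω) : Prop :=
  ∀ t : ℝ≥0, 0 < t → ∀ (x : Rd d) (O : Set (Rd d)), IsOpen O → O.Nonempty →
    0 < M.P x (M.X t ⁻¹' ((↑) '' O))

end MarkovProcess

/-- A Lévy quadruple `(a(x), b(x), c(x), ν(x, dy))` on `ℝ^d`. -/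
structure LevyQuadruple (d : ℕ) where
  a : Rd d → ℝ
  b : Rd d → Rd d
  c : Rd d → Matrix (Fin d) (Fin d) ℝ
  ν : Kernel (Rd d) (Rd d)
  measurable_a : Measurable a
  a_nonneg : ∀ x, 0 ≤ a x
  measurable_b : Measurable b
  measurable_c : ∀ i j, Measurable fun x => c x i j
  /-- symmetric and non-negative definite -/
  posSemidef_c : ∀ x, (c x).PosSemidef
  ν_zero : ∀ x, ν x {0} = 0
  ν_integrable : ∀ x, ∫⁻ y, ENNReal.ofReal (min 1 (‖y‖ ^ 2)) ∂(ν x) < ⊤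

/-- The Lévy–Khintchine symbol
`q(x,ξ) = a(x) - i⟨ξ,b(x)⟩ + ½⟨ξ,c(x)ξ⟩ + ∫ (1 - e^{i⟨ξ,y⟩} + i⟨ξ,y⟩ 1_{B_1(0)}(y)) ν(x,dy)`. -/
def LevyQuadruple.symbol {d : ℕ} (Q : LevyQuadruple d) (x ξ : Rd d) : ℂ :=
  (Q.a x : ℂ) - Complex.I * ((inner ℝ ξ (Q.b x) : ℝ) : ℂ)
    + (1 / 2 : ℂ) * ((∑ i, ∑ j, ξ i * Q.c x i j * ξ j : ℝ) : ℂ)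
    + ∫ y, (1 - Complex.exp (Complex.I * ((inner ℝ ξ y : ℝ) : ℂ))
        + Complex.I *
          (((Metric.ball (0 : Rd d) 1).indicator (fun z => (inner ℝ ξ z : ℝ)) y : ℝ) : ℂ)) ∂(Q.ν x)

/-- `f̂(ξ) = (2π)^{-d} ∫ e^{-i⟨ξ,x⟩} f(x) dx`. -/
def fourierHat {d : ℕ} (f : Rd d → ℝ) (ξ : Rd d) : ℂ :=
  (((2 * Real.pi) ^ d : ℝ) : ℂ)⁻¹ *
    ∫ x, Complex.exp (-(Complex.I * ((inner ℝ ξ x : ℝ) : ℂ))) * (f x : ℂ)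

/-- `M` is a Lévy-type process with Lévy quadruple `Q`. -/
structure IsLevyTypeProcess {d : ℕ} {Ω : Type*} [MeasurableSpace Ω]
    (M : MarkovProcess d Ω) (Q : LevyQuadruple d) : Prop where
  isFeller : M.IsFeller
  /-- `C_c^∞` is contained in the domain of the Feller generator -/
  testFunctions : ∀ f : Rd d → ℝ, MemCcInfty f → ∃ g, M.FellerGenerator f g
  /-- on `C_c^∞` the Feller generator is the pseudo-differential operator with symbol `q`,
  `f ↦ -∫ q(x,ξ) e^{i⟨ξ,x⟩} f̂(ξ) dξ` -/
  hasSymbol : ∀ f g : Rd d → ℝ, MemCcInfty f → M.FellerGenerator f g → ∀ x,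
    (g x : ℂ) = -∫ ξ, Q.symbol x ξ * Complex.exp (Complex.I * ((inner ℝ ξ x : ℝ) : ℂ))
      * fourierHat f ξ
  /-- there is no killing: `q(x,0) = 0` -/
  symbol_zero : ∀ x, Q.symbol x 0 = 0

end LevyType

end

/-!
The process reaches every open set because it can jump there, step by step, within any prescribed
time.

*Generator off the support.* For a test function `f` and `x ∉ supp f`, the generator reduces to
`𝒜 f(x) = ∫ f(x + y) ν(x, dy)` (`integral_symbol_mul_fourierHat`). Fourier inversion turns the
drift and diffusion parts of the symbol into derivatives of `f` at `x`, which vanish. Fubini's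
theorem, justified by the bound `(2 + 3|ξ|²) (1 ∧ |y|²)` on the Lévy–Khintchine integrand, turns
the rest into the integral against `ν(x, ·)`.

*One jump.* Let `|q - p|` lie well inside `(r, R)` and let `f` be a bump function supported in the
ball `B_δ(q)`. Then `𝒜 f > 0` on the closed ball around `p` of radius `δ`, because `ν` charges open
subsets of the shell, and lower semicontinuity gives a positive minimum there. As `P_s f / s`
converges to `𝒜 f` uniformly on this ball, `P_y(X_s ∈ B_δ(q)) > 0` for all `y ∈ B_δ(p)` and all
sufficiently small `s > 0` (`reachesIn_one`).

*Chaining.* Two jumps `w` and `u - w` through the shell produce any small displacement `u`; so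
finitely many jumps lead from `x` to the centre `o` of a ball in the target, and two jumps lead from
`o` back to `o`. Only finitely many pairs of balls occur, hence one bound `s₀` on the time step
serves for all of them, however often the loop at `o` is repeated. Repeating it often enough brings
the time step `t / (m + 2k)` below `s₀`
(`LevyType.MarkovProcess.ReachesIn.transition_pos`).
-/

/-! ### The generator off the support of a test function -/

namespace LevyType

open scoped FourierTransform LineDeriv SchwartzMap

variable {d : ℕ}

/-- The Fourier transform of a Schwartz function in the normalization of `fourierHat`, expressed
through Mathlib's transform, whose kernel is `e^{-2πi⟨ξ,x⟩}`. -/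
noncomputable def schwartzHat (φ : 𝓢(Rd d, ℂ)) (ξ : Rd d) : ℂ :=
  (((2 * Real.pi) ^ d : ℝ) : ℂ)⁻¹ * 𝓕 φ ((2 * Real.pi)⁻¹ • ξ)

theorem fourierHat_eq_schwartzHat {f : Rd d → ℝ} {φ : 𝓢(Rd d, ℂ)} (h : ∀ x, φ x = f x) :
    fourierHat f = schwartzHat φ := by
  ext ξ
  rw [fourierHat, schwartzHat, SchwartzMap.fourier_coe, Real.fourier_eq']
  congr 2 with x
  rw [h, smul_eq_mul, inner_smul_right, real_inner_comm]
  congr 2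
  have := Real.pi_ne_zero
  push_cast
  field_simp

theorem continuous_schwartzHat (φ : 𝓢(Rd d, ℂ)) : Continuous (schwartzHat φ) := by
  unfold schwartzHat
  have := (𝓕 φ).continuous
  fun_prop

theorem integrable_norm_pow_mul_schwartzHat (φ : 𝓢(Rd d, ℂ)) (k : ℕ) :
    Integrable fun ξ => ‖ξ‖ ^ k * ‖schwartzHat φ ξ‖ := by
  have hpi : (2 * Real.pi)⁻¹ ≠ 0 := by positivity
  have h := ((𝓕 φ).integrable_pow_mul volume k).comp_smul hpi
  refine (h.const_mul ((2 * Real.pi) ^ k * ((2 * Real.pi) ^ d)⁻¹)).congr (ae_of_all _ fun ξ => ?_)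
  have hp := Real.pi_pos
  simp only [schwartzHat, norm_smul, norm_mul, norm_inv, mul_pow, Real.norm_eq_abs,
    Complex.norm_real, norm_pow, abs_of_pos hp, abs_two, inv_pow]
  field_simp

theorem integrable_schwartzHat (φ : 𝓢(Rd d, ℂ)) : Integrable (schwartzHat φ) := by
  have := integrable_norm_pow_mul_schwartzHat φ 0
  simp only [pow_zero, one_mul] at this
  exact (integrable_norm_iff (continuous_schwartzHat φ).aestronglyMeasurable).1 this

theorem integrable_exp_mul_schwartzHat (φ : 𝓢(Rd d, ℂ)) (x : Rd d) :
    Integrable fun ξ => Complex.exp (Complex.I * ((inner ℝ ξ x : ℝ) : ℂ)) * schwartzHat φ ξ := by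
  refine (integrable_schwartzHat φ).bdd_mul (c := 1)
    (by fun_prop) (ae_of_all _ fun ξ => ?_)
  rw [Complex.norm_exp_I_mul_ofReal]

/-- Fourier inversion in the normalization of `fourierHat`. -/
theorem integral_exp_mul_schwartzHat (φ : 𝓢(Rd d, ℂ)) (x : Rd d) :
    ∫ ξ, Complex.exp (Complex.I * ((inner ℝ ξ x : ℝ) : ℂ)) * schwartzHat φ ξ = φ x := by
  have hinv : 𝓕⁻ (𝓕 φ) x = φ x := by rw [FourierTransform.fourierInv_fourier_eq]
  rw [← hinv, SchwartzMap.fourierInv_coe, Real.fourierInv_eq']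
  have hp := Real.pi_pos
  have key := Measure.integral_comp_inv_smul_of_nonneg (volume : Measure (Rd d))
    (fun v : Rd d => Complex.exp (((2 * Real.pi * inner ℝ v x : ℝ) : ℂ) * Complex.I) • 𝓕 φ v)
    (R := 2 * Real.pi) (by positivity)
  have e : (fun ξ : Rd d => Complex.exp (Complex.I * ((inner ℝ ξ x : ℝ) : ℂ)) * schwartzHat φ ξ)
      = fun ξ => (((2 * Real.pi) ^ d : ℝ) : ℂ)⁻¹ *
        (Complex.exp (((2 * Real.pi * inner ℝ ((2 * Real.pi)⁻¹ • ξ) x : ℝ) : ℂ) * Complex.I)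
          • 𝓕 φ ((2 * Real.pi)⁻¹ • ξ)) := by
    ext ξ
    rw [schwartzHat, inner_smul_left, mul_left_comm, smul_eq_mul]
    congr 3
    have : (Real.pi : ℂ) ≠ 0 := by exact_mod_cast hp.ne'
    simp
    field_simp
  rw [e, integral_const_mul, key, finrank_euclideanSpace_fin, Complex.real_smul, ← mul_assoc,
    inv_mul_cancel₀ (by exact_mod_cast (by positivity : ((2 * Real.pi) ^ d : ℝ) ≠ 0)), one_mul]

theorem schwartzHat_lineDeriv (φ : 𝓢(Rd d, ℂ)) (m ξ : Rd d) :
    schwartzHat (∂_{m} φ) ξ = Complex.I * ((inner ℝ ξ m : ℝ) : ℂ) * schwartzHat φ ξ := by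
  have hm : (inner ℝ · m : Rd d → ℝ).HasTemperateGrowth :=
    ((innerSL ℝ).flip m).hasTemperateGrowth
  have : (Real.pi : ℂ) ≠ 0 := by exact_mod_cast Real.pi_ne_zero
  rw [schwartzHat, SchwartzMap.fourier_lineDerivOp_eq, schwartzHat]
  simp only [smul_apply, SchwartzMap.smulLeftCLM_apply_apply hm, inner_smul_left,
    smul_eq_mul, Complex.real_smul]
  simp
  field_simp

/-- The integrand `1 - e^{i⟨ξ,y⟩} + i⟨ξ,y⟩ 1_{B_1(0)}(y)` of the Lévy–Khintchine formula. -/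
noncomputable def levyIntegrand (ξ y : Rd d) : ℂ :=
  1 - Complex.exp (Complex.I * ((inner ℝ ξ y : ℝ) : ℂ))
    + Complex.I * (((Metric.ball (0 : Rd d) 1).indicator (fun z => (inner ℝ ξ z : ℝ)) y : ℝ) : ℂ)

theorem levyIntegrand_eq (ξ y : Rd d) : levyIntegrand ξ y =
    1 - Complex.exp (Complex.I * ((inner ℝ ξ y : ℝ) : ℂ))
      + Complex.I * ((inner ℝ ξ y : ℝ) : ℂ)
        * (((Metric.ball (0 : Rd d) 1).indicator (fun _ => (1 : ℝ)) y : ℝ) : ℂ) := by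
  rw [levyIntegrand]
  by_cases hy : y ∈ Metric.ball (0 : Rd d) 1 <;> simp [Set.indicator, hy]

theorem measurable_levyIntegrand :
    Measurable fun p : Rd d × Rd d => levyIntegrand p.1 p.2 := by
  simp only [levyIntegrand_eq]
  have h : Measurable ((Metric.ball (0 : Rd d) 1).indicator (fun _ => (1 : ℝ))) :=
    measurable_const.indicator Metric.isOpen_ball.measurableSet
  have h2 : Measurable fun p : Rd d × Rd d =>
    (Metric.ball (0 : Rd d) 1).indicator (fun _ => (1 : ℝ)) p.2 := h.comp measurable_snd
  fun_prop

theorem norm_one_sub_exp_add_le (s : ℝ) :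
    ‖1 - Complex.exp (Complex.I * (s : ℂ)) + Complex.I * (s : ℂ)‖ ≤ 3 * s ^ 2 := by
  have hn : ‖Complex.I * (s : ℂ)‖ = |s| := by simp
  have e : 1 - Complex.exp (Complex.I * (s : ℂ)) + Complex.I * (s : ℂ)
      = -(Complex.exp (Complex.I * (s : ℂ)) - 1 - Complex.I * s) := by ring
  rcases le_total |s| 1 with h | h
  · rw [e, norm_neg]
    refine (Complex.norm_exp_sub_one_sub_id_le (hn.trans_le h)).trans ?_
    rw [hn, sq_abs]
    nlinarith [sq_nonneg s]
  · have h1 := norm_add_le (1 - Complex.exp (Complex.I * (s : ℂ))) (Complex.I * (s : ℂ))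
    have h2 := norm_sub_le 1 (Complex.exp (Complex.I * (s : ℂ)))
    rw [Complex.norm_exp_I_mul_ofReal, norm_one] at h2
    rw [hn] at h1
    nlinarith [sq_abs s]

theorem norm_levyIntegrand_le (ξ y : Rd d) :
    ‖levyIntegrand ξ y‖ ≤ (2 + 3 * ‖ξ‖ ^ 2) * min 1 (‖y‖ ^ 2) := by
  by_cases hy : ‖y‖ < 1
  · have hb : y ∈ Metric.ball (0 : Rd d) 1 := by simpa using hy
    rw [levyIntegrand, Set.indicator_of_mem hb]
    have h1 := norm_one_sub_exp_add_le (inner ℝ ξ y)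
    have h2 : (inner ℝ ξ y) ^ 2 ≤ (‖ξ‖ * ‖y‖) ^ 2 :=
      sq_le_sq.2 (by rw [abs_of_nonneg (by positivity : 0 ≤ ‖ξ‖ * ‖y‖)]
                     exact abs_real_inner_le_norm ξ y)
    have h3 : ‖y‖ ^ 2 ≤ 1 := by nlinarith [norm_nonneg y]
    rw [min_eq_right h3]
    nlinarith [sq_nonneg ‖y‖]
  · have hb : y ∉ Metric.ball (0 : Rd d) 1 := by simpa using hy
    rw [levyIntegrand, Set.indicator_of_notMem hb]
    have h3 : 1 ≤ ‖y‖ ^ 2 := by nlinarith [norm_nonneg y]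
    rw [min_eq_left h3]
    have h2 := norm_sub_le 1 (Complex.exp (Complex.I * ((inner ℝ ξ y : ℝ) : ℂ)))
    rw [Complex.norm_exp_I_mul_ofReal, norm_one] at h2
    simp only [Complex.ofReal_zero, mul_zero, add_zero]
    nlinarith [sq_nonneg ‖ξ‖]

theorem LevyQuadruple.integrable_min (Q : LevyQuadruple d) (x : Rd d) :
    Integrable (fun y => min 1 (‖y‖ ^ 2)) (Q.ν x) := by
  refine ⟨by fun_prop, ?_⟩
  rw [hasFiniteIntegral_iff_ofReal (ae_of_all _ fun y => by positivity)]
  exact Q.ν_integrable x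

/-- A Lévy measure is σ-finite, as it integrates `1 ∧ |y|²`, which vanishes at the null
set `{0}` only. -/
theorem LevyQuadruple.sigmaFinite (Q : LevyQuadruple d) (x : Rd d) : SigmaFinite (Q.ν x) := by
  obtain ⟨t, ht, h0, hσ⟩ := (Q.integrable_min x).aefinStronglyMeasurable.exists_set_sigmaFinite
  have hnull : Q.ν x tᶜ = 0 := by
    refine measure_mono_null (t := {y | y ∈ tᶜ ∧ ¬ min 1 (‖y‖ ^ 2) = 0} ∪ {0}) ?_
      (measure_union_null ?_ (Q.ν_zero x))
    · intro y hy
      by_cases hy0 : y = 0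
      · exact Or.inr hy0
      · have := norm_pos_iff.2 hy0
        exact Or.inl ⟨hy, (by positivity : 0 < min 1 (‖y‖ ^ 2)).ne'⟩
    · have := (ae_restrict_iff' ht.compl).1 h0
      rw [ae_iff] at this
      convert this using 3
      simp
  have : (Q.ν x).restrict t = Q.ν x :=
    Measure.restrict_eq_self_of_ae_mem (by rw [ae_iff]; exact hnull)
  rwa [this] at hσ

theorem LevyQuadruple.symbol_eq (Q : LevyQuadruple d) (x ξ : Rd d) :
    Q.symbol x ξ = (Q.a x : ℂ) - Complex.I * ((inner ℝ ξ (Q.b x) : ℝ) : ℂ)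
    + (1 / 2 : ℂ) * ((∑ i, ∑ j, ξ i * Q.c x i j * ξ j : ℝ) : ℂ)
    + ∫ y, levyIntegrand ξ y ∂(Q.ν x) := rfl

/-- Integrating the Lévy–Khintchine integrand in the frequency gives the compensated difference
operator. -/
theorem integral_levyIntegrand_mul (φ : 𝓢(Rd d, ℂ)) (x y : Rd d) :
    ∫ ξ, levyIntegrand ξ y *
        (Complex.exp (Complex.I * ((inner ℝ ξ x : ℝ) : ℂ)) * schwartzHat φ ξ)
      = φ x - φ (x + y) + (∂_{y} φ) x
        * (((Metric.ball (0 : Rd d) 1).indicator (fun _ => (1 : ℝ)) y : ℝ) : ℂ) := by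
  have e : ∀ ξ : Rd d, levyIntegrand ξ y *
        (Complex.exp (Complex.I * ((inner ℝ ξ x : ℝ) : ℂ)) * schwartzHat φ ξ) =
      Complex.exp (Complex.I * ((inner ℝ ξ x : ℝ) : ℂ)) * schwartzHat φ ξ
      - Complex.exp (Complex.I * ((inner ℝ ξ (x + y) : ℝ) : ℂ)) * schwartzHat φ ξ
      + Complex.exp (Complex.I * ((inner ℝ ξ x : ℝ) : ℂ)) * schwartzHat (∂_{y} φ) ξ
        * (((Metric.ball (0 : Rd d) 1).indicator (fun _ => (1 : ℝ)) y : ℝ) : ℂ) := by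
    intro ξ
    rw [levyIntegrand_eq, schwartzHat_lineDeriv, inner_add_right, Complex.ofReal_add, mul_add,
      Complex.exp_add]
    ring
  simp_rw [e]
  rw [integral_add, integral_sub, integral_mul_const]
  · simp only [integral_exp_mul_schwartzHat]
  · exact integrable_exp_mul_schwartzHat φ x
  · exact integrable_exp_mul_schwartzHat φ _
  · exact (integrable_exp_mul_schwartzHat φ x).sub (integrable_exp_mul_schwartzHat φ _)
  · exact (integrable_exp_mul_schwartzHat _ x).mul_const _

/-- The double integrand is dominated by `(2 + 3|ξ|²) |φ̂(ξ)| (1 ∧ |y|²)`. -/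
theorem integrable_levyIntegrand_mul (Q : LevyQuadruple d) (φ : 𝓢(Rd d, ℂ)) (x : Rd d) :
    Integrable (fun p : Rd d × Rd d => levyIntegrand p.1 p.2 *
        (Complex.exp (Complex.I * ((inner ℝ p.1 x : ℝ) : ℂ)) * schwartzHat φ p.1))
      (volume.prod (Q.ν x)) := by
  have := Q.sigmaFinite x
  have h1 : Integrable fun ξ : Rd d => (2 + 3 * ‖ξ‖ ^ 2) * ‖schwartzHat φ ξ‖ := by
    refine (((integrable_norm_pow_mul_schwartzHat φ 0).const_mul 2).add
      ((integrable_norm_pow_mul_schwartzHat φ 2).const_mul 3)).congr (ae_of_all _ fun ξ => ?_)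
    simp only [Pi.add_apply]
    ring
  refine (h1.mul_prod (Q.integrable_min x)).mono' ?_ (ae_of_all _ fun p => ?_)
  · have h2 := (continuous_schwartzHat φ).measurable
    have h3 := measurable_levyIntegrand (d := d)
    exact (h3.mul (by fun_prop)).aestronglyMeasurable
  · rw [norm_mul, norm_mul, Complex.norm_exp_I_mul_ofReal, one_mul]
    calc _ ≤ (2 + 3 * ‖p.1‖ ^ 2) * min 1 (‖p.2‖ ^ 2) * ‖schwartzHat φ p.1‖ := by
          gcongr
          exact norm_levyIntegrand_le _ _
      _ = _ := by ring

variable (Q : LevyQuadruple d)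

/-- Off the support of `φ` the local part of the symbol acts as zero, and the part coming from the
Lévy measure only sees the jumps into the support. -/
theorem integral_symbol_mul_schwartzHat (φ : 𝓢(Rd d, ℂ)) {x : Rd d} (hx : x ∉ tsupport φ) :
    -∫ ξ, Q.symbol x ξ * Complex.exp (Complex.I * ((inner ℝ ξ x : ℝ) : ℂ)) * schwartzHat φ ξ
      = ∫ y, φ (x + y) ∂(Q.ν x) := by
  have := Q.sigmaFinite x
  have hφ : φ x = 0 := image_eq_zero_of_notMem_tsupport hx
  have hd1 : ∀ m, x ∉ tsupport (∂_{m} φ : 𝓢(Rd d, ℂ)) := fun m h =>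
    hx (SchwartzMap.tsupport_lineDerivOp_subset m φ h)
  have h1 : ∀ m, (∂_{m} φ : 𝓢(Rd d, ℂ)) x = 0 := fun m => image_eq_zero_of_notMem_tsupport (hd1 m)
  have h2 : ∀ m n, (∂_{n} (∂_{m} φ : 𝓢(Rd d, ℂ)) : 𝓢(Rd d, ℂ)) x = 0 := fun m n => image_eq_zero_of_notMem_tsupport
    fun h => hd1 m (SchwartzMap.tsupport_lineDerivOp_subset n _ h)
  have hF := integrable_levyIntegrand_mul Q φ x
  let e : Fin d → Rd d := fun i => EuclideanSpace.single i 1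
  let E : 𝓢(Rd d, ℂ) → Rd d → ℂ := fun ψ ξ =>
    Complex.exp (Complex.I * ((inner ℝ ξ x : ℝ) : ℂ)) * schwartzHat ψ ξ
  have hE : ∀ ψ, Integrable (E ψ) := fun ψ => integrable_exp_mul_schwartzHat ψ x
  have hEx : ∀ ψ, ∫ ξ, E ψ ξ = ψ x := fun ψ => integral_exp_mul_schwartzHat ψ x
  -- the local part of the symbol multiplies the transform into those of derivatives of `φ`
  have key : ∀ ξ, Q.symbol x ξ * Complex.exp (Complex.I * ((inner ℝ ξ x : ℝ) : ℂ))
        * schwartzHat φ ξ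
      = ((Q.a x : ℂ) * E φ ξ - E (∂_{Q.b x} φ) ξ
        - (∑ i, ∑ j, (1 / 2 * Q.c x i j : ℂ) * E (∂_{e j} (∂_{e i} φ)) ξ))
        + ∫ y, levyIntegrand ξ y * E φ ξ ∂(Q.ν x) := by
    intro ξ
    have hs : (∑ i, ∑ j, (1 / 2 * Q.c x i j : ℂ) * E (∂_{e j} (∂_{e i} φ)) ξ)
        = -((1 / 2 : ℂ) * ((∑ i, ∑ j, ξ i * Q.c x i j * ξ j : ℝ) : ℂ)) * E φ ξ := by
      push_cast
      simp only [Finset.mul_sum, ← Finset.sum_neg_distrib, Finset.sum_mul]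
      refine Finset.sum_congr rfl fun i _ => Finset.sum_congr rfl fun j _ => ?_
      simp only [E, schwartzHat_lineDeriv, e, EuclideanSpace.inner_single_right]
      simp
      linear_combination (1 / 2 * (Q.c x i j : ℂ) * ξ j * ξ i *
        Complex.exp (Complex.I * ((inner ℝ ξ x : ℝ) : ℂ)) * schwartzHat φ ξ) * Complex.I_sq
    rw [hs, Q.symbol_eq, integral_mul_const]
    simp only [E, schwartzHat_lineDeriv]
    ring
  simp_rw [key]
  rw [integral_add, integral_sub, integral_sub, integral_const_mul, hEx, hEx, hφ, h1,
    integral_finsetSum]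
  · have hz : ∀ i, ∫ ξ, ∑ j, (1 / 2 * Q.c x i j : ℂ) * E (∂_{e j} (∂_{e i} φ)) ξ = 0 := by
      intro i
      rw [integral_finsetSum _ fun j _ => (hE _).const_mul _]
      refine Finset.sum_eq_zero fun j _ => ?_
      rw [integral_const_mul, hEx, h2, mul_zero]
    simp only [hz]
    rw [integral_integral_swap hF]
    simp only [E, integral_levyIntegrand_mul, hφ, h1]
    simp [integral_neg]
  · exact fun i _ => integrable_finsetSum _ fun j _ => (hE _).const_mul _
  · exact (hE _).const_mul _
  · exact hE _
  · exact ((hE _).const_mul _).sub (hE _)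
  · exact integrable_finsetSum _ fun i _ => integrable_finsetSum _ fun j _ =>
      (hE _).const_mul _
  · exact (((hE _).const_mul _).sub (hE _)).sub (integrable_finsetSum _ fun i _ =>
      integrable_finsetSum _ fun j _ => (hE _).const_mul _)
  · exact hF.integral_prod_left

/-- Off its support, a Schwartz function is integrable along the jumps: there `-φ(x + y)` is the
frequency integral of the double integrand, which is integrable on the product. -/
theorem integrable_schwartz_add (φ : 𝓢(Rd d, ℂ)) {x : Rd d} (hx : x ∉ tsupport φ) :
    Integrable (fun y => φ (x + y)) (Q.ν x) := by
  have := Q.sigmaFinite x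
  have hφ : φ x = 0 := image_eq_zero_of_notMem_tsupport hx
  have h1 : ∀ m, (∂_{m} φ : 𝓢(Rd d, ℂ)) x = 0 := fun m => image_eq_zero_of_notMem_tsupport fun h =>
    hx (SchwartzMap.tsupport_lineDerivOp_subset m φ h)
  have hF := (integrable_levyIntegrand_mul Q φ x).integral_prod_right
  simp only [integral_levyIntegrand_mul, hφ, h1] at hF
  simpa using hF.neg

/-- Off the support of a test function `f` the generator is `∫ f(x + y) ν(x, dy)`. -/
theorem integral_symbol_mul_fourierHat {f : Rd d → ℝ} (hf : MemCcInfty f) {x : Rd d}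
    (hx : x ∉ tsupport f) :
    Integrable (fun y => f (x + y)) (Q.ν x) ∧
    -∫ ξ, Q.symbol x ξ * Complex.exp (Complex.I * ((inner ℝ ξ x : ℝ) : ℂ)) * fourierHat f ξ
      = ((∫ y, f (x + y) ∂(Q.ν x) : ℝ) : ℂ) := by
  let φ : 𝓢(Rd d, ℂ) := HasCompactSupport.toSchwartzMap (f := fun x => (f x : ℂ))
    (hf.2.comp_left (g := ((↑) : ℝ → ℂ)) Complex.ofReal_zero)
    (Complex.ofRealCLM.contDiff.comp hf.1)
  have hφ : ∀ x, φ x = f x := fun x => rfl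
  have hs : x ∉ tsupport φ := fun h => hx <| closure_mono (fun z hz => by
    rw [Function.mem_support, hφ] at hz
    exact_mod_cast hz) h
  refine ⟨?_, ?_⟩
  · have := integrable_schwartz_add Q φ hs
    simp only [hφ] at this
    simpa using this.re
  · rw [fourierHat_eq_schwartzHat hφ, integral_symbol_mul_schwartzHat Q φ hs]
    simp only [hφ]
    exact integral_ofReal

end LevyType

namespace LevyType

variable {d : ℕ} {Ω : Type*} [MeasurableSpace Ω]

namespace MarkovProcess

/-! ### Transition probabilities and chains of jumps -/

/-- The transition probability `P_x(X_t ∈ B)`. -/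
noncomputable def transition (M : MarkovProcess d Ω) (t : ℝ≥0) (x : Rd d) (B : Set (Rd d)) : ℝ≥0∞ :=
  M.P x (M.X t ⁻¹' ((↑) '' B))

/-- A consequence of the Chapman–Kolmogorov equation. -/
theorem transition_add_pos (M : MarkovProcess d Ω) {s t : ℝ≥0} {x : Rd d} {B C : Set (Rd d)}
    (hB : MeasurableSet B) (hC : MeasurableSet C) (hs : 0 < M.transition s x B)
    (ht : ∀ y ∈ B, 0 < M.transition t y C) : 0 < M.transition (s + t) x C := by
  have := M.isProbabilityMeasure
  by_contra hcon
  have h0 : M.P x (M.X (s + t) ⁻¹' ((↑) '' C)) = 0 := le_antisymm (not_lt.1 hcon) zero_le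
  have hCm : MeasurableSet (M.X (s + t) ⁻¹' ((↑) '' C)) := M.ℱ.le _ _ (M.adapted (s + t) C hC)
  have hBm : MeasurableSet (M.X s ⁻¹' ((↑) '' B)) := M.ℱ.le _ _ (M.adapted s B hB)
  -- the conditional probability of a null event vanishes almost surely
  have hind : (M.X (s + t) ⁻¹' ((↑) '' C)).indicator (fun _ => (1 : ℝ)) =ᵐ[M.P x] 0 :=
    indicator_meas_zero h0
  have hzero := (M.markov x s t C hC).symm.trans
    ((condExp_congr_ae hind).trans (by rw [condExp_zero]))
  refine hs.ne' (measure_mono_null (fun ω hω => ?_) (ae_iff.1 hzero))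
  obtain ⟨y, hy, hyω⟩ := hω
  have hpos : 0 < (M.P y).real (M.X t ⁻¹' ((↑) '' C)) :=
    ENNReal.toReal_pos (ht y hy).ne' (measure_ne_top _ _)
  simp only [Set.mem_ofPred_eq, ← hyω]
  exact hpos.ne'

theorem semigroup_eq_zero (M : MarkovProcess d Ω) {t : ℝ≥0} {x : Rd d} {B : Set (Rd d)}
    {f : Rd d → ℝ} (hf : Function.support f ⊆ B) (h : M.transition t x B = 0) :
    M.semigroup t f x = 0 := by
  refine integral_eq_zero_of_ae ?_
  filter_upwards [measure_eq_zero_iff_ae_notMem.1 h] with ω hω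
  cases hX : M.X t ω with
  | infty => rfl
  | coe y =>
    have hy : y ∉ B := fun hy => hω ⟨y, hy, hX.symm⟩
    exact Function.notMem_support.1 fun h => hy (hf h)

/-- The process reaches `B_δ(q)` from every point of `B_δ(p)` in time `n * s` with positive
probability, for all small `s > 0` simultaneously. -/
def ReachesIn (M : MarkovProcess d Ω) (δ : ℝ) (n : ℕ) (p q : Rd d) : Prop :=
  ∃ s₀ : ℝ≥0, 0 < s₀ ∧ ∀ s : ℝ≥0, 0 < s → s ≤ s₀ → ∀ y ∈ Metric.ball p δ,
    0 < M.transition (n * s) y (Metric.ball q δ)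

theorem ReachesIn.trans {M : MarkovProcess d Ω} {δ : ℝ} {m n : ℕ} {p q o : Rd d}
    (h₁ : M.ReachesIn δ m p q) (h₂ : M.ReachesIn δ n q o) : M.ReachesIn δ (m + n) p o := by
  obtain ⟨s₁, hs₁, h₁⟩ := h₁
  obtain ⟨s₂, hs₂, h₂⟩ := h₂
  refine ⟨min s₁ s₂, lt_min hs₁ hs₂, fun s hs hle y hy => ?_⟩
  rw [Nat.cast_add, add_mul]
  exact M.transition_add_pos Metric.isOpen_ball.measurableSet Metric.isOpen_ball.measurableSet
    (h₁ s hs (hle.trans (min_le_left _ _)) y hy)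
    fun z hz => h₂ s hs (hle.trans (min_le_right _ _)) z hz

/-- A loop at the target can be run through arbitrarily often without shrinking the range of time
steps, so that every positive time is reached. -/
theorem ReachesIn.transition_pos {M : MarkovProcess d Ω} {δ : ℝ} {m : ℕ} {x o : Rd d}
    (hδ : 0 < δ) (h : M.ReachesIn δ m x o) (hloop : M.ReachesIn δ 2 o o)
    {t : ℝ≥0} (ht : 0 < t) : 0 < M.transition t x (Metric.ball o δ) := by
  obtain ⟨s₁, hs₁, h₁⟩ := h
  obtain ⟨s₂, hs₂, h₂⟩ := hloop
  have hk : ∀ s : ℝ≥0, 0 < s → s ≤ min s₁ s₂ → ∀ k : ℕ,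
      0 < M.transition ((m + 2 * k : ℕ) * s) x (Metric.ball o δ) := by
    intro s hs hle k
    induction k with
    | zero => simpa using h₁ s hs (hle.trans (min_le_left _ _)) x (Metric.mem_ball_self hδ)
    | succ k ih =>
      have e : ((m + 2 * (k + 1) : ℕ) : ℝ≥0) * s = (m + 2 * k : ℕ) * s + (2 : ℕ) * s := by
        push_cast; ring
      rw [e]
      exact M.transition_add_pos Metric.isOpen_ball.measurableSet
        Metric.isOpen_ball.measurableSet ih (h₂ s hs (hle.trans (min_le_right _ _)))
  obtain ⟨k, hkt⟩ := exists_nat_gt (t / min s₁ s₂)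
  have hmin : 0 < min s₁ s₂ := lt_min hs₁ hs₂
  have hk0 : 0 < (k : ℝ≥0) := zero_le.trans_lt hkt
  have hN : (k : ℝ≥0) ≤ (m + 2 * k : ℕ) := by
    exact_mod_cast (by omega : k ≤ m + 2 * k)
  have hN0 : 0 < ((m + 2 * k : ℕ) : ℝ≥0) := hk0.trans_le hN
  have := hk (t / (m + 2 * k : ℕ)) (by positivity) (by
    rw [div_le_iff₀ hN0]
    rw [div_lt_iff₀ hmin] at hkt
    calc t ≤ k * min s₁ s₂ := hkt.le
      _ ≤ (m + 2 * k : ℕ) * min s₁ s₂ := by gcongr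
      _ = _ := mul_comm _ _) k
  rwa [mul_div_cancel₀ _ hN0.ne'] at this

end MarkovProcess

open MarkovProcess

/-! ### A single jump -/

/-- A jump whose size lies well inside `(r, R)` is made within every short time. -/
theorem reachesIn_one {M : MarkovProcess d Ω} {Q : LevyQuadruple d} (hM : IsLevyTypeProcess M Q)
    {r R : ℝ} (hr : 0 ≤ r)
    (hν : ∀ O : Set (Rd d), IsOpen O → O.Nonempty →
      O ⊆ Metric.ball 0 R \ Metric.ball 0 r →
      ∀ K : Set (Rd d), IsCompact K → K.Nonempty → 0 < ⨅ x ∈ K, Q.ν x O)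
    (hlsc : ∀ f : Rd d → ℝ, (∀ x, 0 ≤ f x) → LowerSemicontinuous f →
      LowerSemicontinuous fun x => ∫⁻ y, ENNReal.ofReal (f (y + x)) ∂(Q.ν x))
    {δ : ℝ} (hδ : 0 < δ) {p q : Rd d} (h₁ : r + 2 * δ < dist q p) (h₂ : dist q p < R - 2 * δ) :
    M.ReachesIn δ 1 p q := by
  let f : ContDiffBump q := ⟨δ / 2, δ, by positivity, by linarith⟩
  have hf : MemCcInfty f := ⟨f.contDiff, f.hasCompactSupport⟩
  obtain ⟨g, hg⟩ := hM.testFunctions f hf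
  have hnot : ∀ y ∈ Metric.closedBall p δ, y ∉ tsupport f := by
    intro y hy hy'
    rw [f.tsupport_eq] at hy'
    have := dist_triangle_left q p y
    rw [Metric.mem_closedBall] at hy hy'
    have : f.rOut = δ := rfl
    linarith
  have hlin : ∀ y ∈ Metric.closedBall p δ,
      ∫⁻ z, ENNReal.ofReal (f (z + y)) ∂(Q.ν y) = ENNReal.ofReal (g y) := by
    intro y hy
    obtain ⟨hint, heq⟩ := integral_symbol_mul_fourierHat Q hf (hnot y hy)
    rw [← hM.hasSymbol f g hf hg y, Complex.ofReal_inj] at heq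
    rw [heq, ofReal_integral_eq_lintegral_ofReal hint (ae_of_all _ fun z => f.nonneg)]
    simp_rw [add_comm]
  have hpos : ∀ y ∈ Metric.closedBall p δ, 0 < ∫⁻ z, ENNReal.ofReal (f (z + y)) ∂(Q.ν y) := by
    intro y hy
    have hsub : Metric.ball (q - y) (δ / 2) ⊆ Metric.ball 0 R \ Metric.ball 0 r := by
      intro z hz
      rw [Metric.mem_ball, dist_eq_norm] at hz
      rw [Metric.mem_closedBall, dist_eq_norm] at hy
      rw [dist_eq_norm] at h₁ h₂
      have e : z = (q - p) + ((z - (q - y)) - (y - p)) := by abel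
      have hb := norm_sub_le (z - (q - y)) (y - p)
      have hu := norm_add_le (q - p) ((z - (q - y)) - (y - p))
      have hl := norm_sub_le z ((z - (q - y)) - (y - p))
      rw [← e] at hu
      have e' : z - ((z - (q - y)) - (y - p)) = q - p := by abel
      rw [e'] at hl
      simp only [Set.mem_sdiff, mem_ball_zero_iff, not_lt]
      constructor <;> linarith
    have h := hν _ Metric.isOpen_ball ⟨_, Metric.mem_ball_self (by positivity)⟩ hsub {y}
      isCompact_singleton (Set.singleton_nonempty y)
    rw [iInf_singleton] at h
    refine h.trans_le ?_
    rw [← lintegral_indicator_one Metric.isOpen_ball.measurableSet]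
    refine lintegral_mono fun z => ?_
    by_cases hz : z ∈ Metric.ball (q - y) (δ / 2)
    · have hz' : z + y ∈ Metric.closedBall q f.rIn := by
        have hd : dist (z + y) q = dist z (q - y) := by
          rw [dist_eq_norm, dist_eq_norm]; congr 1; abel
        rw [Metric.mem_closedBall, hd]
        exact (Metric.mem_ball.1 hz).le
      simp [hz, f.one_of_mem_closedBall hz']
    · simp [hz]
  -- by lower semicontinuity the generator of `f` attains a positive minimum on the closed ball
  obtain ⟨y₀, hy₀, hmin⟩ := ((hlsc f (fun x => f.nonneg)
    f.continuous.lowerSemicontinuous).lowerSemicontinuousOn (Metric.closedBall p δ)).exists_isMinOn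
    ⟨p, Metric.mem_closedBall_self hδ.le⟩ (isCompact_closedBall p δ)
  have hg₀ : 0 < g y₀ := by
    have := hpos y₀ hy₀
    rwa [hlin y₀ hy₀, ENNReal.ofReal_pos] at this
  have hge : ∀ y ∈ Metric.closedBall p δ, g y₀ ≤ g y := by
    intro y hy
    have h : ENNReal.ofReal (g y₀) ≤ ENNReal.ofReal (g y) := by
      rw [← hlin y₀ hy₀, ← hlin y hy]
      exact hmin hy
    have hgy : 0 < g y := by
      have := hpos y hy
      rwa [hlin y hy, ENNReal.ofReal_pos] at this
    exact (ENNReal.ofReal_le_ofReal_iff hgy.le).1 h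
  have hev := Metric.tendstoUniformly_iff.1 hg.2.2.2 (g y₀) hg₀
  obtain ⟨s₁, hs₁, hsub⟩ := (mem_nhdsGT_iff_exists_Ioc_subset).1 hev
  refine ⟨s₁, hs₁, fun s hs hle y hy => ?_⟩
  have hy' := Metric.ball_subset_closedBall hy
  rw [Nat.cast_one, one_mul, pos_iff_ne_zero]
  intro hzero
  have hd := hsub ⟨hs, hle⟩ y
  rw [M.semigroup_eq_zero f.support_eq.subset hzero,
    image_eq_zero_of_notMem_tsupport (hnot y hy'), sub_zero, zero_div, Real.dist_eq, sub_zero] at hd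
  exact absurd ((le_abs_self _).trans_lt hd) (not_lt.2 (hge y hy'))

end LevyType

/-! ### Open-set irreducibility -/

open LevyType LevyType.MarkovProcess in
theorem proposition3p1 {d : ℕ} (hd : 1 ≤ d) {Ω : Type*} [MeasurableSpace Ω]
    (M : LevyType.MarkovProcess d Ω) (Q : LevyType.LevyQuadruple d)
    (hM : LevyType.IsLevyTypeProcess M Q)
    (r R : ℝ) (hr : 0 ≤ r) (hrR : r < R)
    (hν : ∀ O : Set (LevyType.Rd d), IsOpen O → O.Nonempty →
      O ⊆ Metric.ball 0 R \ Metric.ball 0 r →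
      ∀ K : Set (LevyType.Rd d), IsCompact K → K.Nonempty → 0 < ⨅ x ∈ K, Q.ν x O)
    (hlsc : ∀ f : LevyType.Rd d → ℝ, (∀ x, 0 ≤ f x) → LowerSemicontinuous f →
      LowerSemicontinuous fun x => ∫⁻ y, ENNReal.ofReal (f (y + x)) ∂(Q.ν x)) :
    M.OpenSetIrreducible := by
  intro t ht x O hO ⟨o, ho⟩
  obtain ⟨ε, hε, hεO⟩ := Metric.isOpen_iff.1 hO o ho
  set η := (R - r) / 8 with hη
  have hη0 : 0 < η := by rw [hη]; linarith
  set δ := min ε η with hδ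
  have hδ0 : 0 < δ := lt_min hε hη0
  have hδη : δ ≤ η := min_le_right _ _
  -- a vector in the middle of the shell exists because `1 ≤ d`
  obtain ⟨w, hw⟩ : ∃ w : Rd d, ‖w‖ = (r + R) / 2 :=
    have : Nonempty (Fin d) := ⟨⟨0, hd⟩⟩
    exists_norm_eq (Rd d) (by linarith)
  have hstep : ∀ p q : Rd d, r + 2 * δ < ‖q - p‖ → ‖q - p‖ < R - 2 * δ →
      M.ReachesIn δ 1 p q := fun p q h₁ h₂ =>
    reachesIn_one hM hr hν hlsc hδ0 (by rwa [dist_eq_norm]) (by rwa [dist_eq_norm])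
  -- a jump by `w` followed by a jump by `u - w` gives a small displacement `u`
  have htwo : ∀ p u : Rd d, ‖u‖ ≤ η → M.ReachesIn δ 2 p (p + u) := by
    intro p u hu
    have e₁ : p + w - p = w := by abel
    have e₂ : p + u - (p + w) = u - w := by abel
    have h₁ := norm_sub_norm_le w u
    have h₂ := norm_sub_le u w
    rw [norm_sub_rev w u] at h₁
    have s₁ := hstep p (p + w) (by rw [e₁]; linarith) (by rw [e₁]; linarith)
    have s₂ := hstep (p + w) (p + u) (by rw [e₂]; linarith) (by rw [e₂]; linarith)
    have s₃ := ReachesIn.trans s₁ s₂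
    rwa [one_add_one_eq_two] at s₃
  obtain ⟨k, hk⟩ := exists_nat_gt (‖o - x‖ / η)
  have hk0 : (0 : ℝ) < k := (by positivity : 0 ≤ ‖o - x‖ / η).trans_lt hk
  have hu : ‖(k : ℝ)⁻¹ • (o - x)‖ ≤ η := by
    rw [norm_smul, norm_inv, Real.norm_natCast, inv_mul_le_iff₀ hk0]
    rw [div_lt_iff₀ hη0] at hk
    exact hk.le
  have hchain : ∀ j : ℕ, M.ReachesIn δ (2 * (j + 1)) x (x + (j + 1) • ((k : ℝ)⁻¹ • (o - x))) := by
    intro j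
    induction j with
    | zero => simpa using htwo x _ hu
    | succ j ih =>
      have := ih.trans (htwo _ _ hu)
      rwa [add_assoc, ← succ_nsmul] at this
  obtain ⟨j, rfl⟩ : ∃ j, k = j + 1 := Nat.exists_eq_succ_of_ne_zero (by rintro rfl; simp at hk0)
  have hxo := hchain j
  rw [← Nat.cast_smul_eq_nsmul ℝ, smul_inv_smul₀ hk0.ne', add_sub_cancel] at hxo
  have hloop := htwo o 0 (by simpa using hη0.le)
  rw [add_zero] at hloop
  exact (hxo.transition_pos hδ0 hloop ht).trans_le (measure_mono (Set.preimage_mono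
    (Set.image_mono ((Metric.ball_subset_ball (min_le_left _ _)).trans hεO))))
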